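/- Let $K$ be a field, $S=K[x_1,\dots,x_d]$, let $m_1,\dots,m_r$ be monomials in $S$ (for instance, the minimal generators of a monomial ideal $I=\langle m_1,\dots,m_r\rangle$), and let $k\ge 0$ be an integer. For $\sigma\subseteq\{1,\dots,r\}$ put $m_\sigma=\operatorname{lcm}(m_i : i\in\sigma)$, with $m_\emptyset=1$, and let $$I_k=\langle m_\sigma : \sigma\subseteq\{1,\dots,r\},\ |\sigma|=k\rangle\subseteq S$$ be the $k$-fold lcm-ideal. For $i\ge 0$ let $F_i$ be the free $S$-module with basis the symbols $[\sigma,\tau]$, where $\sigma,\tau\subseteq\{1,\dots,r\}$ are disjoint, $|\sigma|=k$, $|\tau|=i$ and every element of $\tau$ is smaller than $\max(\sigma)$ (no condition if $\tau=\emptyset$); a symbol $[\sigma,\tau]$ for which the last condition fails is read as $0$. For $j\in\tau$ let $\operatorname{sgn}(j,\tau)$ be the number of elements of $\tau$ larger than $j$. Define $\partial:F_{i+1}\to F_i$ by $$\partial[\sigma,\tau]=\sum_{j\in\tau}(-1)^{\operatorname{sgn}(j,\tau)}\left(-\frac{m_{\sigma\cup\tau}}{m_{(\sigma\cup\tau)\setminus\{j\}}}\,[\sigma,\tau\setminus\{j\}]+\frac{m_{\sigma\cup\tau}}{m_{(\sigma\cup\tau)\setminus\{\max(\sigma)\}}}\,\bigl[(\sigma\setminus\{\max(\sigma)\})\cup\{j\},\tau\setminus\{j\}\bigr]\right)$$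 and $\varepsilon:F_0\to I_k$ by $\varepsilon[\sigma,\emptyset]=m_\sigma$. (For $d=r$ and $m_i=x_i$ this is the Aramova–Herzog–Hibi resolution of the $k$-out-of-$r$ ideal; in general it is its degeneration along the lcm map $\sigma\mapsto m_\sigma$.) Then $$\mathbf I_k:\quad \cdots\xrightarrow{\ \partial\ }F_1\xrightarrow{\ \partial\ }F_0\xrightarrow{\ \varepsilon\ }I_k\longrightarrow 0$$ is a free resolution of $I_k$ over $S$. Moreover, let $I_{k,r}\subseteq R=K[x_1,\dots,x_r]$ be the ideal generated by all products of $k$ different variables (the squarefree Veronese ideal). Then $\beta_i(I_k)\le\beta_i(I_{k,r})$ for every $i\ge 0$, where $\beta_i(I_k)=\dim_K\operatorname{Tor}_i^S(K,I_k)$ and $\beta_i(I_{k,r})=\dim_K\operatorname{Tor}_i^R(K,I_{k,r})$ are the total Betti numbers and $K$ is the quotient of $S$, respectively $R$, by the ideal generated by the variables. -/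

import Mathlib

open CategoryTheory

universe u v w

namespace LcmFiltration

/-- The pairs `[σ, τ]` of disjoint subsets of `{1, …, r}` with `|σ| = k`, `|τ| = i` and
`max σ > max τ` (no condition if `τ` is empty). -/
def Admissible {r : ℕ} (k i : ℕ) (σ τ : Finset (Fin r)) : Prop :=
  Disjoint σ τ ∧ σ.card = k ∧ τ.card = i ∧ ∀ t ∈ τ, ∃ s ∈ σ, t < s

/-- The basis of the free module in homological degree `i`. -/
abbrev AdmissiblePair (r k i : ℕ) : Type :=
  {p : Finset (Fin r) × Finset (Fin r) // Admissible k i p.1 p.2}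

theorem AdmissiblePair.nonempty {r k i : ℕ} (p : AdmissiblePair r k (i + 1)) :
    p.1.1.Nonempty := by
  obtain ⟨⟨σ, τ⟩, -, -, hc, hm⟩ := p
  have hτ : τ.Nonempty := Finset.card_pos.mp (by simp only at hc; omega)
  obtain ⟨t, ht⟩ := hτ
  obtain ⟨s, hs, -⟩ := hm t ht
  exact ⟨s, hs⟩

section Complex

variable (K : Type u) [Field K] {d r : ℕ}

/-- The free module `F_i` over `K[x_1, …, x_d]` with basis the pairs `[σ, τ]`, `|τ| = i`. -/
abbrev PairModule (d r k i : ℕ) : Type u :=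
  AdmissiblePair r k i →₀ MvPolynomial (Fin d) K

open Classical in
/-- The basis element `[σ, τ]` of `F_i`, with the convention that `[σ, τ] = 0` when the pair is
not admissible. -/
noncomputable def bracket (d : ℕ) {r : ℕ} (k i : ℕ) (σ τ : Finset (Fin r)) :
    PairModule K d r k i :=
  if h : Admissible k i σ τ then Finsupp.single ⟨(σ, τ), h⟩ 1 else 0

/-- `sgn(j, τ)`, the number of elements of `τ` that are larger than `j`. -/
def sgn {r : ℕ} (j : Fin r) (τ : Finset (Fin r)) : ℕ := (τ.filter (fun t => j < t)).card

/-- The Aramova–Herzog–Hibi differential `F_{i+1} → F_i` of the `k`-out-of-`r` ideal, written for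
an arbitrary label map `f` from subsets of `{1, …, r}` to exponent vectors, where `[σ, τ]` has
multidegree `f (σ ∪ τ)`:

`∂[σ, τ] = ∑_{j ∈ τ} (-1)^{sgn(j, τ)} (- x^{f(σ ∪ τ) - f(σ ∪ τ - j)} [σ, τ - j]
  + x^{f(σ ∪ τ) - f(σ ∪ τ - max σ)} [σ - max σ + j, τ - j])`,

with `[μ, ρ] = 0` if `max ρ > max μ`. If `max τ < max (σ - max σ)`, all the terms are present; if
`max τ > max (σ - max σ)`, the second term survives only for `j = max τ`, where its sign is `+`.

For `f σ` the indicator vector of `σ`, the two monomials are `x_j` and `x_{max σ}`, and this is the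
resolution of the `k`-out-of-`r` ideal itself. For a monotone `f` that sends unions to least common
multiples, it is the `f`-degeneration of that resolution: the same scalars, with the multidegrees
replaced by their images under `f`. -/
noncomputable def labelledDifferential (f : Finset (Fin r) → (Fin d →₀ ℕ)) (k i : ℕ) :
    PairModule K d r k (i + 1) →ₗ[MvPolynomial (Fin d) K] PairModule K d r k i :=
  Finsupp.linearCombination (MvPolynomial (Fin d) K) fun p =>
    let σ := p.1.1
    let τ := p.1.2
    let M := σ.max' p.nonempty
    ∑ j ∈ τ, (-1 : MvPolynomial (Fin d) K) ^ sgn j τ •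
      (-(MvPolynomial.monomial (f (σ ∪ τ) - f ((σ ∪ τ).erase j)) (1 : K) •
          bracket K d k i σ (τ.erase j)) +
        MvPolynomial.monomial (f (σ ∪ τ) - f ((σ ∪ τ).erase M)) (1 : K) •
          bracket K d k i (insert j (σ.erase M)) (τ.erase j))

/-- The exponent vector of `m_σ = lcm (m_i : i ∈ σ)`, where `m i` is the exponent vector of the
`i`-th monomial. -/
noncomputable def lcmExp (m : Fin r → (Fin d →₀ ℕ)) (σ : Finset (Fin r)) : Fin d →₀ ℕ :=
  σ.sup m

/-- The `k`-fold lcm-ideal `I_k` of the monomials `m_1, …, m_r`. -/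
noncomputable def lcmIdeal (m : Fin r → (Fin d →₀ ℕ)) (k : ℕ) :
    Ideal (MvPolynomial (Fin d) K) :=
  Ideal.span {g | ∃ σ : Finset (Fin r), σ.card = k ∧ g = MvPolynomial.monomial (lcmExp m σ) 1}

/-- The `k`-out-of-`r` ideal `I_{k,r}` of `K[x_1, …, x_r]`, generated by the products of `k`
different variables (the squarefree Veronese ideal). -/
noncomputable def kOutOfIdeal (k r : ℕ) : Ideal (MvPolynomial (Fin r) K) :=
  Ideal.span {g | ∃ σ : Finset (Fin r), σ.card = k ∧ g = ∏ i ∈ σ, MvPolynomial.X i}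

/-- The differential `F_{i+1} → F_i` of `𝐈_k`: the degeneration of the Aramova–Herzog–Hibi
differential along the lcm map `σ ↦ m_σ`. -/
noncomputable def lcmDifferential (m : Fin r → (Fin d →₀ ℕ)) (k i : ℕ) :
    PairModule K d r k (i + 1) →ₗ[MvPolynomial (Fin d) K] PairModule K d r k i :=
  labelledDifferential K (lcmExp m) k i

/-- The augmentation `F_0 → I_k`, `[σ, ∅] ↦ m_σ`, of `𝐈_k`. -/
noncomputable def lcmAugmentation (m : Fin r → (Fin d →₀ ℕ)) (k : ℕ) :
    PairModule K d r k 0 →ₗ[MvPolynomial (Fin d) K] lcmIdeal K m k :=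
  Finsupp.linearCombination (MvPolynomial (Fin d) K) fun p =>
    (⟨MvPolynomial.monomial (lcmExp m p.1.1) 1,
      Ideal.subset_span ⟨p.1.1, p.2.2.1, rfl⟩⟩ : lcmIdeal K m k)

end Complex

/-- The sequence `⋯ → F 2 → F 1 → F 0 → M → 0` is exact and all `F i` are free. -/
structure IsFreeResolution (S : Type u) [CommRing S] (F : ℕ → Type v)
    [∀ i, AddCommGroup (F i)] [∀ i, Module S (F i)] (M : Type w) [AddCommGroup M] [Module S M]
    (δ : ∀ i, F (i + 1) →ₗ[S] F i) (ε : F 0 →ₗ[S] M) : Prop where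
  free : ∀ i, Module.Free S (F i)
  exact_succ : ∀ i, Function.Exact (δ (i + 1)) (δ i)
  exact_zero : Function.Exact (δ 0) ε
  surjective : Function.Surjective ε

/-- The `i`-th (total) Betti number `dim_K Tor_i^S (K, J)` of an ideal `J` of
`S = K[x_1, …, x_d]`, where `K = S / (x_1, …, x_d)`. -/
noncomputable def bettiNumber {K : Type u} [Field K] {d : ℕ} (i : ℕ)
    (J : Ideal (MvPolynomial (Fin d) K)) : Cardinal.{u} :=
  Module.rank K ((ModuleCat.restrictScalars (algebraMap K (MvPolynomial (Fin d) K))).obj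
    (((Tor (ModuleCat.{u} (MvPolynomial (Fin d) K)) i).obj
      (ModuleCat.of (MvPolynomial (Fin d) K)
        (MvPolynomial (Fin d) K ⧸
          Ideal.span (Set.range (MvPolynomial.X : Fin d → MvPolynomial (Fin d) K))))).obj
      (ModuleCat.of (MvPolynomial (Fin d) K) J)))

end LcmFiltration

/-!
The complex `𝐈_k` is multigraded, with `[σ, τ]` in multidegree `m_{σ ∪ τ}`. Since
`m_A` divides `x^b` exactly when `A` is contained in `W_b = {i | m_i divides x^b}`, the strand of
multidegree `b` is the `K`-complex spanned by the pairs `[σ, τ]` with `σ ∪ τ ⊆ W_b`, and in it all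
monomial coefficients become `1` (`lcmDifferential_strand`). So the strand depends on the set `W_b`
only, and it is enough to treat one scalar complex for each vertex set `W ⊆ {1, …, r}`.

The scalar differential squares to zero (`scalarDifferential_comp_self`): up to sign, the result of
removing first `j` and then `l` from `τ` is symmetric in `j` and `l`. The augmented scalar complex
is contractible (`exists_scalarHomotopy`), by induction on `W`. Let `n` be the largest element of
`W ∪ {n}`. If `|W| < k`, there is at most one pair. Otherwise, modulo the complex of `W`, only the
pairs with `n ∈ σ` remain, `σ` is fixed by the differential, and `τ` runs over all subsets of the
nonempty set `W \ σ`: this is an augmented simplex, which is contracted onto its largest vertex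
(`sub_coneHomotopy_mem`). The contractions of the strands assemble to a `K`-linear homotopy on
`𝐈_k`, which gives exactness.

For the Betti numbers, `Tor_i(K, I_k)` is the homology of `K ⊗ F`, hence a subquotient of
`K ⊗ F_i`, whose dimension is the number of basis elements `[σ, τ]`; this number does not depend
on the monomials. The ideal `I_{k,r}` is the `k`-fold lcm-ideal of the variables, and its
resolution is minimal, because each coefficient of the differential is `± x_j`
(`lcmDifferential_single_mem`). So the bound is attained for `I_{k,r}`.
-/

namespace LcmFiltration

/-! ### The scalar complex -/

section Scalar

variable (K : Type u) [Field K] {r : ℕ}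

/-- The condition `max σ > max τ`, which is void for `τ = ∅`. -/
def Dominates (σ τ : Finset (Fin r)) : Prop := ∀ t ∈ τ, ∃ s ∈ σ, t < s

/-- The set `σ` without its maximum; it is empty if `σ` is. -/
def dropMax (σ : Finset (Fin r)) : Finset (Fin r) := σ.filter (fun a => ∃ b ∈ σ, a < b)

/-- The `K`-vector space on all pairs of subsets of `{1, …, r}`, admissible or not. -/
abbrev PairSpace (r : ℕ) : Type u := (Finset (Fin r) × Finset (Fin r)) →₀ K

open Classical in
/-- The basis vector `[σ, τ]`, read as `0` unless `max σ > max τ`. -/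
noncomputable def scalarBracket (σ τ : Finset (Fin r)) : PairSpace K r :=
  if Dominates σ τ then Finsupp.single (σ, τ) 1 else 0

/-- The Aramova–Herzog–Hibi differential with all monomial coefficients set to `1`. -/
noncomputable def scalarDifferential : PairSpace K r →ₗ[K] PairSpace K r :=
  Finsupp.linearCombination K fun p => ∑ j ∈ p.2, (-1 : K) ^ sgn j p.2 •
    (-scalarBracket K p.1 (p.2.erase j) +
      scalarBracket K (insert j (dropMax p.1)) (p.2.erase j))

/-- The pairs `[σ, τ]` with `|σ| = k` that are admissible and supported in `W`. -/
def pairsIn (k : ℕ) (W : Finset (Fin r)) : Set (Finset (Fin r) × Finset (Fin r)) :=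
  {p | Disjoint p.1 p.2 ∧ p.1.card = k ∧ Dominates p.1 p.2 ∧ p.1 ∪ p.2 ⊆ W}

/-- The span of the admissible pairs supported in `W`: the scalar complex of the vertex set `W`,
with all homological degrees taken together. -/
noncomputable abbrev scalarComplex (k : ℕ) (W : Finset (Fin r)) : Submodule K (PairSpace K r) :=
  Finsupp.supported K K (pairsIn k W)

/-- The augmentation `[σ, ∅] ↦ 1`, extended by `0` to positive homological degree. -/
noncomputable def scalarAugmentation : PairSpace K r →ₗ[K] K :=
  Finsupp.linearCombination K fun p => if p.2 = ∅ then 1 else 0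

variable {K}

theorem mem_dropMax {σ : Finset (Fin r)} {a : Fin r} :
    a ∈ dropMax σ ↔ a ∈ σ ∧ ∃ b ∈ σ, a < b := by simp [dropMax]

theorem dropMax_subset (σ : Finset (Fin r)) : dropMax σ ⊆ σ := Finset.filter_subset _ _

theorem dropMax_eq_erase_max' {σ : Finset (Fin r)} (h : σ.Nonempty) :
    dropMax σ = σ.erase (σ.max' h) := by
  ext a
  rw [mem_dropMax, Finset.mem_erase]
  constructor
  · rintro ⟨ha, b, hb, hab⟩
    exact ⟨(hab.trans_le (σ.le_max' b hb)).ne, ha⟩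
  · rintro ⟨hne, ha⟩
    exact ⟨ha, _, σ.max'_mem h, lt_of_le_of_ne (σ.le_max' a ha) hne⟩

theorem Dominates.mono {σ σ' τ τ' : Finset (Fin r)} (h : Dominates σ τ) (hσ : σ ⊆ σ')
    (hτ : τ' ⊆ τ) : Dominates σ' τ' := fun t ht =>
  let ⟨s, hs, hts⟩ := h t (hτ ht); ⟨s, hσ hs, hts⟩

theorem scalarBracket_of_dominates {σ τ : Finset (Fin r)} (h : Dominates σ τ) :
    scalarBracket K σ τ = Finsupp.single (σ, τ) 1 := if_pos h

theorem scalarBracket_of_not_dominates {σ τ : Finset (Fin r)} (h : ¬ Dominates σ τ) :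
    scalarBracket K σ τ = 0 := if_neg h

theorem scalarDifferential_single (σ τ : Finset (Fin r)) :
    scalarDifferential K (Finsupp.single (σ, τ) 1) = ∑ j ∈ τ, (-1 : K) ^ sgn j τ •
      (-scalarBracket K σ (τ.erase j) + scalarBracket K (insert j (dropMax σ)) (τ.erase j)) := by
  simp [scalarDifferential]

theorem card_insert_dropMax {σ : Finset (Fin r)} (h : σ.Nonempty) {j : Fin r} (hj : j ∉ σ) :
    (insert j (dropMax σ)).card = σ.card := by
  rw [Finset.card_insert_of_notMem (fun h' => hj (dropMax_subset σ h')),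
    dropMax_eq_erase_max' h, Finset.card_erase_add_one (σ.max'_mem h)]

/-! ### The scalar differential squares to zero -/

theorem sgn_erase_of_lt {τ : Finset (Fin r)} {j l : Fin r} (h : j < l) :
    sgn l (τ.erase j) = sgn l τ := by
  unfold sgn
  congr 1
  ext t
  simp only [Finset.mem_filter, Finset.mem_erase]
  constructor
  · rintro ⟨⟨-, ht⟩, hlt⟩
    exact ⟨ht, hlt⟩
  · rintro ⟨ht, hlt⟩
    exact ⟨⟨(h.trans hlt).ne', ht⟩, hlt⟩

theorem sgn_erase_add_one {τ : Finset (Fin r)} {j l : Fin r} (h : j < l) (hl : l ∈ τ) :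
    sgn j (τ.erase l) + 1 = sgn j τ := by
  unfold sgn
  rw [Finset.filter_erase, Finset.card_erase_add_one]
  simp [hl, h]

/-- The signs of the two orders in which `j` and `l` can be removed from `τ` are opposite. -/
theorem sign_swap {τ : Finset (Fin r)} {j l : Fin r} (hne : l ≠ j) (hj : j ∈ τ) (hl : l ∈ τ) :
    (-1 : K) ^ sgn j τ * (-1) ^ sgn l (τ.erase j) =
      -((-1 : K) ^ sgn l τ * (-1) ^ sgn j (τ.erase l)) := by
  rcases lt_or_gt_of_ne hne with h | h
  · rw [sgn_erase_of_lt h, ← sgn_erase_add_one h hj]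
    ring
  · rw [sgn_erase_of_lt h, ← sgn_erase_add_one h hl]
    ring

theorem sum_sign_smul_eq_zero {M : Type*} [AddCommGroup M] [Module K M] (τ : Finset (Fin r))
    (T : Fin r → Fin r → M) (hT : ∀ j ∈ τ, ∀ l ∈ τ, l ≠ j → T j l = T l j) :
    ∑ j ∈ τ, (-1 : K) ^ sgn j τ • ∑ l ∈ τ.erase j, (-1 : K) ^ sgn l (τ.erase j) • T j l = 0 := by
  simp only [Finset.smul_sum, smul_smul]
  rw [Finset.sum_sigma']
  refine Finset.sum_involution (fun x _ => ⟨x.2, x.1⟩) ?_ ?_ ?_ ?_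
  · rintro ⟨j, l⟩ h
    simp only [Finset.mem_sigma, Finset.mem_erase] at h
    obtain ⟨hj, hne, hl⟩ := h
    simp only
    rw [hT j hj l hl hne, sign_swap hne hj hl, neg_smul, neg_add_cancel]
  · rintro ⟨j, l⟩ h _ heq
    simp only [Finset.mem_sigma, Finset.mem_erase] at h
    simp only [Sigma.mk.injEq, heq_eq_eq] at heq
    exact h.2.1 heq.1
  · rintro ⟨j, l⟩ h
    simp only [Finset.mem_sigma, Finset.mem_erase] at h ⊢
    exact ⟨h.2.2, h.2.1.symm, h.1⟩
  · rintro ⟨j, l⟩ h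
    rfl

theorem dropMax_insert_of_dominated {σ : Finset (Fin r)} {j : Fin r} (h : ∃ s ∈ σ, j < s) :
    dropMax (insert j σ) = insert j (dropMax σ) := by
  obtain ⟨s, hs, hjs⟩ := h
  ext a
  simp only [mem_dropMax, Finset.mem_insert]
  constructor
  · rintro ⟨rfl | ha, b, rfl | hb, hab⟩
    · exact Or.inl rfl
    · exact Or.inl rfl
    · exact Or.inr ⟨ha, s, hs, hab.trans hjs⟩
    · exact Or.inr ⟨ha, b, hb, hab⟩
  · rintro (rfl | ⟨ha, b, hb, hab⟩)
    · exact ⟨Or.inl rfl, s, Or.inr hs, hjs⟩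
    · exact ⟨Or.inr ha, b, Or.inr hb, hab⟩

theorem dropMax_insert_of_forall_lt {σ : Finset (Fin r)} {j : Fin r} (h : ∀ s ∈ σ, s < j) :
    dropMax (insert j σ) = σ := by
  ext a
  simp only [mem_dropMax, Finset.mem_insert]
  constructor
  · rintro ⟨rfl | ha, b, rfl | hb, hab⟩
    · exact absurd hab (lt_irrefl _)
    · exact absurd (h b hb) hab.asymm
    · exact ha
    · exact ha
  · intro ha
    exact ⟨Or.inr ha, j, Or.inl rfl, h a ha⟩

open Classical in
/-- The part of the double differential of `[σ, τ]` in which `j` is removed from `τ` first and `l`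
second, without its sign. -/
noncomputable def secondTerm (σ τ : Finset (Fin r)) (j l : Fin r) : PairSpace K r :=
  scalarBracket K σ ((τ.erase j).erase l)
    - scalarBracket K (insert l (dropMax σ)) ((τ.erase j).erase l)
    + if Dominates (insert j (dropMax σ)) (τ.erase j) then
        -scalarBracket K (insert j (dropMax σ)) ((τ.erase j).erase l)
          + scalarBracket K (insert l (dropMax (insert j (dropMax σ)))) ((τ.erase j).erase l)
      else 0

/-- The second differential acts on a bracket of the first one only if that bracket is not
truncated; this is the condition in `secondTerm`. -/
theorem scalarDifferential_scalarDifferential_single {σ τ : Finset (Fin r)}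
    (h : Dominates σ τ) :
    scalarDifferential K (scalarDifferential K (Finsupp.single (σ, τ) 1)) =
      ∑ j ∈ τ, (-1 : K) ^ sgn j τ •
        ∑ l ∈ τ.erase j, (-1 : K) ^ sgn l (τ.erase j) • secondTerm σ τ j l := by
  rw [scalarDifferential_single, map_sum]
  refine Finset.sum_congr rfl fun j _ => ?_
  rw [map_smul, map_add, map_neg, scalarBracket_of_dominates
    (h.mono subset_rfl (Finset.erase_subset j τ)), scalarDifferential_single]
  congr 1
  by_cases hj : Dominates (insert j (dropMax σ)) (τ.erase j)
  · rw [scalarBracket_of_dominates hj, scalarDifferential_single, ← Finset.sum_neg_distrib,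
      ← Finset.sum_add_distrib]
    refine Finset.sum_congr rfl fun l _ => ?_
    rw [← smul_neg, ← smul_add, secondTerm, if_pos hj]
    congr 1
    abel
  · rw [scalarBracket_of_not_dominates hj, map_zero, add_zero, ← Finset.sum_neg_distrib]
    refine Finset.sum_congr rfl fun l _ => ?_
    rw [← smul_neg, secondTerm, if_neg hj]
    congr 1
    abel

/-- The double differential is symmetric, up to sign, in the two removed elements. -/
theorem secondTerm_comm {σ τ : Finset (Fin r)} (hd : Disjoint σ τ)
    {j l : Fin r} (hj : j ∈ τ) (hl : l ∈ τ) (hne : l ≠ j) :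
    secondTerm (K := K) σ τ j l = secondTerm σ τ l j := by
  unfold secondTerm
  rw [Finset.erase_right_comm (a := l) (b := j)]
  by_cases hlow : Dominates (dropMax σ) τ
  · -- No bracket is truncated: `max τ` is below the second largest element of `σ`.
    have hdom : ∀ i, Dominates (insert i (dropMax σ)) (τ.erase i) := fun i =>
      hlow.mono (Finset.subset_insert _ _) (Finset.erase_subset _ _)
    rw [if_pos (hdom j), if_pos (hdom l), dropMax_insert_of_dominated (hlow j hj),
      dropMax_insert_of_dominated (hlow l hl), Finset.insert_comm]
    abel
  · -- Otherwise only the largest element `t` of `τ` can be exchanged into `σ`.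
    have hτ : τ.Nonempty := ⟨j, hj⟩
    obtain ⟨t, htτ, htmax⟩ : ∃ t ∈ τ, ∀ i ∈ τ, i ≤ t :=
      ⟨τ.max' hτ, τ.max'_mem hτ, fun i hi => τ.le_max' i hi⟩
    have htlow : ∀ s ∈ dropMax σ, s < t := by
      intro s hs
      refine lt_of_le_of_ne ?_ ?_
      · by_contra! hts
        exact hlow fun i hi => ⟨s, hs, (htmax i hi).trans_lt hts⟩
      · rintro rfl
        exact Finset.disjoint_left.mp hd (dropMax_subset σ hs) htτ
    have hnot : ∀ i ∈ τ, ∀ τ' : Finset (Fin r), t ∈ τ' →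
        ¬ Dominates (insert i (dropMax σ)) τ' := by
      intro i hi τ' ht hdom
      obtain ⟨s, hs, hts⟩ := hdom t ht
      rcases Finset.mem_insert.mp hs with rfl | hs
      · exact (htmax s hi).not_gt hts
      · exact (htlow s hs).asymm hts
    have htdom : Dominates (insert t (dropMax σ)) (τ.erase t) := fun i hi =>
      ⟨t, Finset.mem_insert_self _ _, lt_of_le_of_ne (htmax i (Finset.mem_of_mem_erase hi))
        (Finset.ne_of_mem_erase hi)⟩
    have hdrop := dropMax_insert_of_forall_lt htlow
    by_cases hjt : j = t
    · subst hjt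
      rw [if_pos htdom, if_neg (hnot l hl _ (Finset.mem_erase.mpr ⟨hne.symm, hj⟩)), hdrop]
      abel
    · by_cases hlt : l = t
      · subst hlt
        rw [if_pos htdom, if_neg (hnot j hj _ (Finset.mem_erase.mpr ⟨hne, hl⟩)), hdrop]
        abel
      · have ht' : t ∈ (τ.erase j).erase l := by
          simp only [Finset.mem_erase]
          exact ⟨Ne.symm hlt, Ne.symm hjt, htτ⟩
        rw [if_neg (hnot l hl _ (Finset.mem_erase.mpr ⟨Ne.symm hlt, htτ⟩)),
          if_neg (hnot j hj _ (Finset.mem_erase.mpr ⟨Ne.symm hjt, htτ⟩)),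
          scalarBracket_of_not_dominates (hnot l hl _ ht'),
          scalarBracket_of_not_dominates (hnot j hj _ ht')]

theorem map_mem_of_single {M : Type*} [AddCommGroup M] [Module K M]
    {A : Set (Finset (Fin r) × Finset (Fin r))} (N : Submodule K M) (φ : PairSpace K r →ₗ[K] M)
    (h : ∀ σ τ, (σ, τ) ∈ A → φ (Finsupp.single (σ, τ) 1) ∈ N) {c : PairSpace K r}
    (hc : c ∈ Finsupp.supported K K A) : φ c ∈ N := by
  have : Finsupp.supported K K A ≤ N.comap φ := by
    rw [Finsupp.supported_eq_span_single, Submodule.span_le]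
    rintro _ ⟨⟨σ, τ⟩, hp, rfl⟩
    exact h σ τ hp
  exact this hc

theorem eq_of_eq_single {M : Type*} [AddCommGroup M] [Module K M]
    {A : Set (Finset (Fin r) × Finset (Fin r))} (φ ψ : PairSpace K r →ₗ[K] M)
    (h : ∀ σ τ, (σ, τ) ∈ A → φ (Finsupp.single (σ, τ) 1) = ψ (Finsupp.single (σ, τ) 1))
    {c : PairSpace K r} (hc : c ∈ Finsupp.supported K K A) : φ c = ψ c := by
  have := map_mem_of_single (⊥ : Submodule K M) (φ - ψ)
    (fun σ τ hp => by simp [h σ τ hp]) hc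
  simpa [sub_eq_zero] using this

theorem single_mem_scalarComplex {k : ℕ} {W σ τ : Finset (Fin r)} (h : (σ, τ) ∈ pairsIn k W)
    (a : K) : Finsupp.single (σ, τ) a ∈ scalarComplex K k W :=
  Finsupp.single_mem_supported K a h

theorem scalarDifferential_comp_self {k : ℕ} {W : Finset (Fin r)} {c : PairSpace K r}
    (hc : c ∈ scalarComplex K k W) : scalarDifferential K (scalarDifferential K c) = 0 := by
  refine eq_of_eq_single (scalarDifferential K ∘ₗ scalarDifferential K) 0
    (fun σ τ hp => ?_) hc
  rw [LinearMap.comp_apply, scalarDifferential_scalarDifferential_single hp.2.2.1]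
  exact sum_sign_smul_eq_zero τ _ fun j hj l hl hne =>
    secondTerm_comm hp.1 hj hl hne

/-! ### Subcomplexes on vertex sets and the augmentation -/

theorem Dominates.nonempty {σ τ : Finset (Fin r)} (h : Dominates σ τ) (hτ : τ.Nonempty) :
    σ.Nonempty := let ⟨t, ht⟩ := hτ; let ⟨s, hs, _⟩ := h t ht; ⟨s, hs⟩

theorem disjoint_insert_dropMax_erase {σ τ : Finset (Fin r)} (hd : Disjoint σ τ) (j : Fin r) :
    Disjoint (insert j (dropMax σ)) (τ.erase j) := by
  rw [Finset.disjoint_insert_left]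
  exact ⟨Finset.notMem_erase j τ,
    hd.mono (dropMax_subset σ) (Finset.erase_subset j τ)⟩

theorem scalarBracket_mem {k : ℕ} {W σ τ : Finset (Fin r)} (hd : Disjoint σ τ)
    (hk : σ.card = k) (hW : σ ∪ τ ⊆ W) : scalarBracket K σ τ ∈ scalarComplex K k W := by
  by_cases h : Dominates σ τ
  · rw [scalarBracket_of_dominates h]
    exact single_mem_scalarComplex ⟨hd, hk, h, hW⟩ 1
  · rw [scalarBracket_of_not_dominates h]
    exact zero_mem _

/-- The second summand of the differential trades the maximum of `σ` for `j`, so it lives on any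
vertex set that contains the rest of `σ` and `τ`. -/
theorem exchange_mem {k : ℕ} {W σ τ : Finset (Fin r)} (hp : (σ, τ) ∈ pairsIn k W) {j : Fin r}
    (hj : j ∈ τ) {W' : Finset (Fin r)} (hW' : dropMax σ ∪ τ ⊆ W') :
    scalarBracket K (insert j (dropMax σ)) (τ.erase j) ∈ scalarComplex K k W' := by
  obtain ⟨hd, hk, hdom, hW⟩ := hp
  refine scalarBracket_mem (disjoint_insert_dropMax_erase hd j) ?_ ?_
  · rw [card_insert_dropMax (hdom.nonempty ⟨j, hj⟩) (Finset.disjoint_right.mp hd hj), hk]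
  · refine Finset.Subset.trans ?_ hW'
    intro a
    simp only [Finset.mem_union, Finset.mem_insert, Finset.mem_erase]
    rintro ((rfl | h) | h)
    · exact Or.inr hj
    · exact Or.inl h
    · exact Or.inr h.2

theorem scalarDifferential_mem {k : ℕ} {W : Finset (Fin r)} {c : PairSpace K r}
    (hc : c ∈ scalarComplex K k W) : scalarDifferential K c ∈ scalarComplex K k W := by
  refine map_mem_of_single _ _ (fun σ τ hp => ?_) hc
  rw [scalarDifferential_single]
  refine Submodule.sum_mem _ fun j hj => Submodule.smul_mem _ _ (Submodule.add_mem _ ?_ ?_)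
  · exact Submodule.neg_mem _ (scalarBracket_mem (hp.1.mono_right (Finset.erase_subset j τ)) hp.2.1
      ((Finset.union_subset_union subset_rfl (Finset.erase_subset j τ)).trans hp.2.2.2))
  · exact exchange_mem hp hj
      ((Finset.union_subset_union (dropMax_subset σ) subset_rfl).trans hp.2.2.2)

theorem scalarAugmentation_single (σ τ : Finset (Fin r)) :
    scalarAugmentation K (Finsupp.single (σ, τ) 1) = if τ = ∅ then 1 else 0 := by
  simp [scalarAugmentation]

theorem scalarAugmentation_scalarDifferential {k : ℕ} {W : Finset (Fin r)} {c : PairSpace K r}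
    (hc : c ∈ scalarComplex K k W) : scalarAugmentation K (scalarDifferential K c) = 0 := by
  refine eq_of_eq_single (scalarAugmentation K ∘ₗ scalarDifferential K) 0 (fun σ τ hp => ?_) hc
  rw [LinearMap.comp_apply, scalarDifferential_single, map_sum]
  refine Finset.sum_eq_zero fun j hj => ?_
  rw [map_smul, map_add, map_neg, scalarBracket_of_dominates
    (hp.2.2.1.mono subset_rfl (Finset.erase_subset j τ)), scalarAugmentation_single]
  by_cases h : τ.erase j = ∅
  · rw [scalarBracket_of_dominates (by rw [h]; exact fun t ht => absurd ht (Finset.notMem_empty t)),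
      scalarAugmentation_single]
    simp
  · by_cases h' : Dominates (insert j (dropMax σ)) (τ.erase j)
    · rw [scalarBracket_of_dominates h', scalarAugmentation_single]
      simp
    · rw [scalarBracket_of_not_dominates h']
      simp [h]

end Scalar

/-! ### Acyclicity of the scalar complex -/

section Acyclic

variable (K : Type u) [Field K] {r : ℕ}

/-- The homotopy that contracts, for each `σ ∋ n`, the simplex of all `τ ⊆ W \ σ` onto the vertex
`w = max (W \ σ)`: it sends `[σ, τ]` to `-[σ, τ ∪ {w}]`, or to `0` if `w ∈ τ`. With the largest
vertex `w`, the sign of `w` in `τ ∪ {w}` is `+`. -/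
noncomputable def coneHomotopy (n : Fin r) (W : Finset (Fin r)) :
    PairSpace K r →ₗ[K] PairSpace K r :=
  Finsupp.linearCombination K fun p =>
    if h : n ∈ p.1 ∧ (W \ p.1).Nonempty then
      if (W \ p.1).max' h.2 ∈ p.2 then 0
      else -Finsupp.single (p.1, insert ((W \ p.1).max' h.2) p.2) 1
    else 0

variable {K}

theorem coneHomotopy_single_of_notMem {n : Fin r} (W : Finset (Fin r)) {σ : Finset (Fin r)}
    (τ : Finset (Fin r)) (hn : n ∉ σ) :
    coneHomotopy K n W (Finsupp.single (σ, τ) 1) = 0 := by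
  simp [coneHomotopy, hn]

theorem coneHomotopy_single {n : Fin r} {W : Finset (Fin r)} {σ : Finset (Fin r)}
    (τ : Finset (Fin r)) (hn : n ∈ σ) {w : Fin r} (hw : w ∈ W \ σ) (hmax : ∀ x ∈ W \ σ, x ≤ w) :
    coneHomotopy K n W (Finsupp.single (σ, τ) 1) =
      if w ∈ τ then 0 else -Finsupp.single (σ, insert w τ) 1 := by
  have h : n ∈ σ ∧ (W \ σ).Nonempty := ⟨hn, w, hw⟩
  have hw' : (W \ σ).max' h.2 = w :=
    le_antisymm (hmax _ (Finset.max'_mem _ _)) (Finset.le_max' _ _ hw)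
  simp only [coneHomotopy, Finsupp.linearCombination_single, one_smul]
  rw [dif_pos h, hw']

theorem coneHomotopy_eq_zero {n : Fin r} {W W' : Finset (Fin r)} (hn : n ∉ W') {k : ℕ}
    {c : PairSpace K r} (hc : c ∈ scalarComplex K k W') : coneHomotopy K n W c = 0 :=
  eq_of_eq_single _ 0 (fun _ τ hp => coneHomotopy_single_of_notMem W τ fun h =>
    hn (hp.2.2.2 (Finset.mem_union_left _ h))) hc

/-- If `n` is the largest vertex and lies in `σ`, then `n` is exchanged for a smaller vertex by the
second summand of the differential, so modulo pairs without `n` only the first one remains. -/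
theorem scalarDifferential_single_add_mem {n : Fin r} {W : Finset (Fin r)} (hW : ∀ x ∈ W, x < n)
    {k : ℕ} {σ τ : Finset (Fin r)} (hp : (σ, τ) ∈ pairsIn k (insert n W)) (hn : n ∈ σ) :
    scalarDifferential K (Finsupp.single (σ, τ) 1) +
      ∑ j ∈ τ, (-1 : K) ^ sgn j τ • Finsupp.single (σ, τ.erase j) 1 ∈ scalarComplex K k W := by
  rw [scalarDifferential_single, ← Finset.sum_add_distrib]
  refine Submodule.sum_mem _ fun j hj => ?_
  rw [← smul_add, scalarBracket_of_dominates
    (hp.2.2.1.mono subset_rfl (Finset.erase_subset j τ)), neg_add_cancel_comm]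
  refine Submodule.smul_mem _ _ (exchange_mem hp hj fun a ha => ?_)
  have hle : ∀ b ∈ σ ∪ τ, b ≤ n := fun b hb => by
    rcases Finset.mem_insert.mp (hp.2.2.2 hb) with rfl | h
    · exact le_rfl
    · exact (hW b h).le
  have hane : a ≠ n := by
    rintro rfl
    rcases Finset.mem_union.mp ha with h | h
    · obtain ⟨-, b, hb, hab⟩ := mem_dropMax.mp h
      exact (hle b (Finset.mem_union_left _ hb)).not_gt hab
    · exact Finset.disjoint_left.mp hp.1 hn h
  have ha' := hp.2.2.2 (Finset.union_subset_union (dropMax_subset σ) subset_rfl ha)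
  exact (Finset.mem_insert.mp ha').resolve_left hane

theorem pairsIn_insert_notMem {n : Fin r} {W : Finset (Fin r)} (hW : ∀ x ∈ W, x < n)
    {k : ℕ} {σ τ : Finset (Fin r)} (hp : (σ, τ) ∈ pairsIn k (insert n W)) (hn : n ∉ σ) :
    (σ, τ) ∈ pairsIn k W := by
  refine ⟨hp.1, hp.2.1, hp.2.2.1, fun a ha => ?_⟩
  refine (Finset.mem_insert.mp (hp.2.2.2 ha)).resolve_left ?_
  rintro rfl
  obtain ⟨s, hs, has⟩ := hp.2.2.1 a ((Finset.mem_union.mp ha).resolve_left hn)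
  rcases Finset.mem_insert.mp (hp.2.2.2 (Finset.mem_union_left _ hs)) with rfl | h
  · exact lt_irrefl _ has
  · exact (hW s h).asymm has

theorem exists_max_sdiff {n : Fin r} {W : Finset (Fin r)} (hW : ∀ x ∈ W, x < n) {σ : Finset (Fin r)}
    (hn : n ∈ σ) (hk : σ.card ≤ W.card) :
    ∃ w ∈ W \ σ, ∀ x ∈ W \ σ, x ≤ w := by
  have hne : (W \ σ).Nonempty := by
    rw [Finset.sdiff_nonempty]
    intro hsub
    have : insert n W ⊆ σ := Finset.insert_subset hn hsub
    have hcard := Finset.card_le_card this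
    rw [Finset.card_insert_of_notMem fun h => lt_irrefl _ (hW n h)] at hcard
    omega
  exact ⟨_, Finset.max'_mem _ hne, fun x hx => Finset.le_max' _ x hx⟩

theorem coneHomotopy_mem {n : Fin r} {W : Finset (Fin r)} (hW : ∀ x ∈ W, x < n) {k : ℕ}
    (hk : k ≤ W.card) {c : PairSpace K r} (hc : c ∈ scalarComplex K k (insert n W)) :
    coneHomotopy K n W c ∈ scalarComplex K k (insert n W) := by
  refine map_mem_of_single _ _ (fun σ τ hp => ?_) hc
  by_cases hn : n ∈ σ
  · obtain ⟨w, hw, hmax⟩ := exists_max_sdiff hW hn (hp.2.1.le.trans hk)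
    obtain ⟨hwW, hwσ⟩ := Finset.mem_sdiff.mp hw
    rw [coneHomotopy_single τ hn hw hmax]
    split_ifs with hwτ
    · exact zero_mem _
    · refine Submodule.neg_mem _ (single_mem_scalarComplex (τ := insert w τ) ⟨?_, hp.2.1, ?_, ?_⟩ 1)
      · exact Finset.disjoint_insert_right.mpr ⟨hwσ, hp.1⟩
      · intro t ht
        rcases Finset.mem_insert.mp ht with rfl | ht
        · exact ⟨n, hn, hW _ hwW⟩
        · exact hp.2.2.1 t ht
      · rw [Finset.union_insert]
        exact Finset.insert_subset (Finset.mem_insert_of_mem hwW) hp.2.2.2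
  · rw [coneHomotopy_single_of_notMem W τ hn]
    exact zero_mem _

theorem scalarAugmentation_coneHomotopy (n : Fin r) (W : Finset (Fin r)) (c : PairSpace K r) :
    scalarAugmentation K (coneHomotopy K n W c) = 0 := by
  induction c using Finsupp.induction_linear with
  | zero => simp
  | add f g hf hg => rw [map_add, map_add, hf, hg, add_zero]
  | single p a =>
    simp only [coneHomotopy, Finsupp.linearCombination_single, map_smul]
    split_ifs with h h'
    · simp
    · rw [map_neg, scalarAugmentation_single]
      simp
    · simp

theorem sgn_insert_of_lt {τ : Finset (Fin r)} {j w : Fin r} (hw : w ∉ τ) (h : j < w) :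
    sgn j (insert w τ) = sgn j τ + 1 := by
  rw [← sgn_erase_add_one h (Finset.mem_insert_self w τ), Finset.erase_insert hw]

theorem sgn_eq_zero {τ : Finset (Fin r)} {w : Fin r} (h : ∀ t ∈ τ, t ≤ w) : sgn w τ = 0 := by
  unfold sgn
  rw [Finset.card_eq_zero, Finset.filter_eq_empty_iff]
  exact fun t ht => (h t ht).not_gt

/-- Modulo the pairs on the smaller vertex set `W`, the cone homotopy contracts the complex of the
pairs on `W ∪ {n}`, as soon as `W` has at least `k` elements. -/
theorem sub_coneHomotopy_mem {n : Fin r} {W : Finset (Fin r)} (hW : ∀ x ∈ W, x < n) {k : ℕ}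
    (hk : k ≤ W.card) {c : PairSpace K r} (hc : c ∈ scalarComplex K k (insert n W)) :
    c - scalarDifferential K (coneHomotopy K n W c) - coneHomotopy K n W (scalarDifferential K c)
      ∈ scalarComplex K k W := by
  have hnW : n ∉ W := fun h => lt_irrefl _ (hW n h)
  refine map_mem_of_single _ (LinearMap.id - scalarDifferential K ∘ₗ coneHomotopy K n W
    - coneHomotopy K n W ∘ₗ scalarDifferential K) (fun σ τ hp => ?_) hc
  simp only [LinearMap.sub_apply, LinearMap.id_apply, LinearMap.comp_apply]
  by_cases hn : n ∈ σ
  · obtain ⟨w, hw, hmax⟩ := exists_max_sdiff hW hn (hp.2.1.le.trans hk)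
    obtain ⟨hwW, hwσ⟩ := Finset.mem_sdiff.mp hw
    have hτ : ∀ t ∈ τ, t ∈ W \ σ := fun t ht => by
      have htσ := Finset.disjoint_right.mp hp.1 ht
      refine Finset.mem_sdiff.mpr ⟨(Finset.mem_insert.mp
        (hp.2.2.2 (Finset.mem_union_right _ ht))).resolve_left ?_, htσ⟩
      rintro rfl
      exact htσ hn
    have hs := coneHomotopy_eq_zero (K := K) (W := W) hnW
      (scalarDifferential_single_add_mem hW hp hn)
    rw [map_add, ← eq_neg_iff_add_eq_zero, map_sum] at hs
    rw [hs]
    by_cases hwτ : w ∈ τ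
    · -- Only the term of the boundary that lacks `w` survives the homotopy.
      rw [coneHomotopy_single τ hn hw hmax, if_pos hwτ, map_zero, Finset.sum_eq_single w]
      · rw [map_smul, coneHomotopy_single _ hn hw hmax, if_neg (Finset.notMem_erase w τ),
          Finset.insert_erase hwτ, sgn_eq_zero fun t ht => hmax t (hτ t ht)]
        simp
      · intro j hj hjw
        rw [map_smul, coneHomotopy_single _ hn hw hmax,
          if_pos (Finset.mem_erase.mpr ⟨hjw.symm, hwτ⟩), smul_zero]
      · exact fun h => absurd hwτ h
    · have hp' : (σ, insert w τ) ∈ pairsIn k (insert n W) := by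
        refine ⟨Finset.disjoint_insert_right.mpr ⟨hwσ, hp.1⟩, hp.2.1, fun t ht => ?_, ?_⟩
        · rcases Finset.mem_insert.mp ht with rfl | ht
          · exact ⟨n, hn, hW _ hwW⟩
          · exact hp.2.2.1 t ht
        · rw [Finset.union_insert]
          exact Finset.insert_subset (Finset.mem_insert_of_mem hwW) hp.2.2.2
      have hmem := scalarDifferential_single_add_mem (K := K) hW hp' hn
      rw [Finset.sum_insert hwτ, Finset.erase_insert hwτ, sgn_eq_zero fun t ht => by
        rcases Finset.mem_insert.mp ht with rfl | ht
        · exact le_rfl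
        · exact hmax t (hτ t ht)] at hmem
      rw [coneHomotopy_single τ hn hw hmax, if_neg hwτ]
      convert hmem using 1
      have hsum : ∑ j ∈ τ, coneHomotopy K n W
            ((-1 : K) ^ sgn j τ • Finsupp.single (σ, τ.erase j) 1) =
          ∑ j ∈ τ, (-1 : K) ^ sgn j (insert w τ) •
            Finsupp.single (σ, (insert w τ).erase j) 1 := by
        refine Finset.sum_congr rfl fun j hj => ?_
        have hjw : j ≠ w := fun h => hwτ (h ▸ hj)
        rw [map_smul, coneHomotopy_single _ hn hw hmax,
          if_neg fun h => hwτ (Finset.mem_of_mem_erase h),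
          sgn_insert_of_lt hwτ (lt_of_le_of_ne (hmax j (hτ j hj)) hjw),
          Finset.erase_insert_of_ne hjw.symm, pow_succ, smul_neg, mul_neg_one, neg_smul]
      rw [hsum, map_neg, pow_zero, one_smul]
      abel
  · have hp' := pairsIn_insert_notMem hW hp hn
    rw [coneHomotopy_single_of_notMem W τ hn, map_zero, coneHomotopy_eq_zero hnW
      (scalarDifferential_mem (single_mem_scalarComplex hp' 1)), sub_zero, sub_zero]
    exact single_mem_scalarComplex hp' 1

theorem pairsIn_eq_of_card_le {k : ℕ} {W σ τ : Finset (Fin r)} (hp : (σ, τ) ∈ pairsIn k W)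
    (hW : W.card ≤ k) : σ = W ∧ τ = ∅ := by
  have hσ : σ = W := Finset.eq_of_subset_of_card_le
    (Finset.subset_union_left.trans hp.2.2.2) (hW.trans hp.2.1.ge)
  refine ⟨hσ, Finset.eq_empty_of_forall_notMem fun t ht => ?_⟩
  refine Finset.disjoint_right.mp hp.1 ht ?_
  rw [hσ]
  exact hp.2.2.2 (Finset.mem_union_right _ ht)

/-- With at most `k` vertices, the only possible pair is `[W, ∅]`, for `|W| = k`. -/
theorem exists_scalarHomotopy_of_card_le {k : ℕ} {W : Finset (Fin r)} (hW : W.card ≤ k) :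
    ∃ (H : PairSpace K r →ₗ[K] PairSpace K r) (e : PairSpace K r),
      (∀ c ∈ scalarComplex K k W, H c ∈ scalarComplex K k W) ∧
      ∀ c ∈ scalarComplex K k W,
        scalarDifferential K (H c) + H (scalarDifferential K c) =
          c - scalarAugmentation K c • e := by
  refine ⟨0, Finsupp.single (W, ∅) 1, fun c _ => zero_mem _, fun c hc => ?_⟩
  simp only [LinearMap.zero_apply, map_zero, add_zero]
  refine eq_of_eq_single 0 (LinearMap.id -
    (scalarAugmentation K).smulRight (Finsupp.single (W, ∅) 1)) (fun σ τ hp => ?_) hc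
  obtain ⟨rfl, rfl⟩ := pairsIn_eq_of_card_le hp hW
  simp [scalarAugmentation_single]

/-- The augmented scalar complex of every vertex set is contractible, where the augmentation goes to
`K` if there are admissible pairs; otherwise the complex is zero and `e` is irrelevant. The homotopy
is built by adding the vertices in increasing order. -/
theorem exists_scalarHomotopy (k : ℕ) (W : Finset (Fin r)) :
    ∃ (H : PairSpace K r →ₗ[K] PairSpace K r) (e : PairSpace K r),
      (∀ c ∈ scalarComplex K k W, H c ∈ scalarComplex K k W) ∧
      ∀ c ∈ scalarComplex K k W,
        scalarDifferential K (H c) + H (scalarDifferential K c) =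
          c - scalarAugmentation K c • e := by
  induction W using Finset.induction_on_max with
  | empty => exact exists_scalarHomotopy_of_card_le (by simp)
  | insert n W hW ih =>
    rcases lt_or_ge W.card k with hk | hk
    · exact exists_scalarHomotopy_of_card_le
        ((Finset.card_insert_le n W).trans (Nat.succ_le_of_lt hk))
    · -- The homotopy `s` contracts everything modulo the complex of `W`; the error term `φ` is a
      -- chain map into the complex of `W`, where the homotopy `H` applies.
      obtain ⟨H, e, hH, hHe⟩ := ih
      have hle : scalarComplex K k W ≤ scalarComplex K k (insert n W) :=
        Finsupp.supported_mono fun p hp =>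
          ⟨hp.1, hp.2.1, hp.2.2.1, hp.2.2.2.trans (Finset.subset_insert n W)⟩
      let D := scalarDifferential K (r := r)
      let s := coneHomotopy K n W
      let φ : PairSpace K r →ₗ[K] PairSpace K r := LinearMap.id - D ∘ₗ s - s ∘ₗ D
      have hφ : ∀ c ∈ scalarComplex K k (insert n W), φ c ∈ scalarComplex K k W :=
        fun c hc => sub_coneHomotopy_mem hW hk hc
      have hs : ∀ c ∈ scalarComplex K k (insert n W), s c ∈ scalarComplex K k (insert n W) :=
        fun c hc => coneHomotopy_mem hW hk hc
      refine ⟨s + H ∘ₗ φ, e, fun c hc => add_mem (hs c hc) (hle (hH _ (hφ c hc))),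
        fun c hc => ?_⟩
      have hφD : φ (D c) = D (φ c) := by
        simp only [φ, LinearMap.sub_apply, LinearMap.id_apply, LinearMap.comp_apply, map_sub]
        rw [show D (D c) = 0 from scalarDifferential_comp_self hc,
          show D (D (s c)) = 0 from scalarDifferential_comp_self (hs c hc)]
        simp
      have hεφ : scalarAugmentation K (φ c) = scalarAugmentation K c := by
        simp only [φ, LinearMap.sub_apply, LinearMap.id_apply, LinearMap.comp_apply, map_sub]
        rw [show scalarAugmentation K (D (s c)) = 0 from
            scalarAugmentation_scalarDifferential (hs c hc),
          show scalarAugmentation K (s (D c)) = 0 from scalarAugmentation_coneHomotopy n W _]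
        simp
      have key := hHe (φ c) (hφ c hc)
      rw [hεφ] at key
      change D (s c + H (φ c)) + (s (D c) + H (φ (D c))) = _
      rw [hφD, map_add, add_add_add_comm, key]
      simp only [φ, LinearMap.sub_apply, LinearMap.id_apply, LinearMap.comp_apply]
      abel

end Acyclic

/-! ### Strands of the lcm complex -/

section Strands

variable (K : Type u) [Field K] {d r : ℕ} (m : Fin r → (Fin d →₀ ℕ)) (k i : ℕ)

/-- The map from the scalar complex to the strand of multidegree `b` of the complex `𝐈_k`:
`[σ, τ] ↦ x^b / m_{σ ∪ τ} [σ, τ]`. Pairs that are no basis elements of `F_i` go to `0`. It is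
meaningful on the pairs whose multidegree `m_{σ ∪ τ}` divides `x^b`. -/
noncomputable def strand (b : Fin d →₀ ℕ) : PairSpace K r →ₗ[K] PairModule K d r k i :=
  Finsupp.linearCombination K fun p =>
    MvPolynomial.monomial (b - lcmExp m (p.1 ∪ p.2)) (1 : K) • bracket K d k i p.1 p.2

open Classical in
/-- The vertices whose monomials divide `x^b`. -/
noncomputable def verticesBelow (b : Fin d →₀ ℕ) : Finset (Fin r) :=
  Finset.univ.filter fun i => m i ≤ b

variable {K}

theorem lcmExp_le_iff {m : Fin r → (Fin d →₀ ℕ)} {A : Finset (Fin r)} {b : Fin d →₀ ℕ} :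
    lcmExp m A ≤ b ↔ A ⊆ verticesBelow m b := by
  simp [lcmExp, Finset.sup_le_iff, Finset.subset_iff, verticesBelow]

theorem lcmExp_mono {A B : Finset (Fin r)} (h : A ⊆ B) : lcmExp m A ≤ lcmExp m B :=
  Finset.sup_mono h

theorem bracket_of_admissible {i k : ℕ} {σ τ : Finset (Fin r)} (h : Admissible k i σ τ) :
    bracket K d k i σ τ = Finsupp.single ⟨(σ, τ), h⟩ 1 := dif_pos h

theorem bracket_of_not_admissible {i k : ℕ} {σ τ : Finset (Fin r)} (h : ¬ Admissible k i σ τ) :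
    bracket K d k i σ τ = 0 := dif_neg h

theorem strand_single (b : Fin d →₀ ℕ) (σ τ : Finset (Fin r)) :
    strand K m k i b (Finsupp.single (σ, τ) 1) =
      MvPolynomial.monomial (b - lcmExp m (σ ∪ τ)) (1 : K) • bracket K d k i σ τ := by
  simp [strand]

theorem strand_scalarBracket (b : Fin d →₀ ℕ) (σ τ : Finset (Fin r)) :
    strand K m k i b (scalarBracket K σ τ) =
      MvPolynomial.monomial (b - lcmExp m (σ ∪ τ)) (1 : K) • bracket K d k i σ τ := by
  by_cases h : Dominates σ τ
  · rw [scalarBracket_of_dominates h, strand_single]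
  · rw [scalarBracket_of_not_dominates h, map_zero,
      bracket_of_not_admissible fun h' => h h'.2.2.2, smul_zero]

theorem insert_dropMax_union_erase {σ τ : Finset (Fin r)} (hd : Disjoint σ τ) (h : σ.Nonempty)
    {j : Fin r} (hj : j ∈ τ) :
    insert j (dropMax σ) ∪ τ.erase j = (σ ∪ τ).erase (σ.max' h) := by
  have hM := Finset.disjoint_left.mp hd (σ.max'_mem h)
  rw [dropMax_eq_erase_max' h, Finset.erase_union_distrib, Finset.erase_eq_of_notMem hM,
    Finset.insert_union, ← Finset.union_insert, Finset.insert_erase hj]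

variable {k i}

theorem lcmDifferential_single {σ τ : Finset (Fin r)} (h : Admissible k (i + 1) σ τ)
    (hσ : σ.Nonempty) :
    lcmDifferential K m k i (Finsupp.single ⟨(σ, τ), h⟩ 1) =
      ∑ j ∈ τ, (-1 : MvPolynomial (Fin d) K) ^ sgn j τ •
        (-(MvPolynomial.monomial (lcmExp m (σ ∪ τ) - lcmExp m ((σ ∪ τ).erase j)) (1 : K) •
            bracket K d k i σ (τ.erase j)) +
          MvPolynomial.monomial (lcmExp m (σ ∪ τ) - lcmExp m ((σ ∪ τ).erase (σ.max' hσ))) (1 : K) •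
            bracket K d k i (insert j (dropMax σ)) (τ.erase j)) := by
  rw [lcmDifferential, labelledDifferential, Finsupp.linearCombination_single, one_smul]
  simp only [dropMax_eq_erase_max' hσ]

theorem neg_one_pow_smul_eq {M : Type*} [AddCommGroup M] [Module (MvPolynomial (Fin d) K) M]
    [Module K M] (n : ℕ) (x : M) :
    (-1 : MvPolynomial (Fin d) K) ^ n • x = (-1 : K) ^ n • x := by
  rcases neg_one_pow_eq_or (MvPolynomial (Fin d) K) n with h | h <;>
    rcases Nat.even_or_odd n with h' | h' <;>
    simp [h'.neg_one_pow]

/-- The strands of `𝐈_k` do not depend on the monomials beyond their vertex sets: in each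
multidegree the differential is the scalar one. -/
theorem lcmDifferential_strand (b : Fin d →₀ ℕ) {c : PairSpace K r}
    (hc : c ∈ scalarComplex K k (verticesBelow m b)) :
    lcmDifferential K m k i (strand K m k (i + 1) b c) =
      strand K m k i b (scalarDifferential K c) := by
  refine eq_of_eq_single ((lcmDifferential K m k i).restrictScalars K ∘ₗ strand K m k (i + 1) b)
    (strand K m k i b ∘ₗ scalarDifferential K) (fun σ τ hp => ?_) hc
  rw [LinearMap.comp_apply, LinearMap.comp_apply, LinearMap.restrictScalars_apply, strand_single,
    scalarDifferential_single, map_sum, map_smul]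
  obtain ⟨hd, hk, hdom, hW⟩ := hp
  by_cases hτ : τ.card = i + 1
  · have hadm : Admissible k (i + 1) σ τ := ⟨hd, hk, hτ, hdom⟩
    have hτne : τ.Nonempty := Finset.card_pos.mp (by omega)
    have hσ : σ.Nonempty := hdom.nonempty hτne
    rw [bracket_of_admissible hadm, lcmDifferential_single m hadm hσ, Finset.smul_sum]
    refine Finset.sum_congr rfl fun j hj => ?_
    have hjσ := Finset.disjoint_right.mp hd hj
    have hmul : ∀ a : Fin r,
        (MvPolynomial.monomial (b - lcmExp m (σ ∪ τ)) (1 : K)) *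
          MvPolynomial.monomial (lcmExp m (σ ∪ τ) - lcmExp m ((σ ∪ τ).erase a)) (1 : K) =
        MvPolynomial.monomial (b - lcmExp m ((σ ∪ τ).erase a)) (1 : K) := fun a => by
      rw [MvPolynomial.monomial_mul, one_mul, tsub_add_tsub_cancel (lcmExp_le_iff.mpr hW)
        (lcmExp_mono m (Finset.erase_subset _ _))]
    rw [smul_comm, neg_one_pow_smul_eq, map_smul, map_add, map_neg, strand_scalarBracket,
      strand_scalarBracket, smul_add, smul_neg, smul_smul, smul_smul, hmul, hmul,
      insert_dropMax_union_erase hd hσ hj, Finset.erase_union_distrib,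
      Finset.erase_eq_of_notMem hjσ]
  · rw [bracket_of_not_admissible fun h => hτ h.2.2.1, map_zero, smul_zero]
    refine (Finset.sum_eq_zero fun j hj => ?_).symm
    have hcard : (τ.erase j).card ≠ i := by
      have := Finset.card_erase_add_one hj
      omega
    rw [map_smul, map_add, map_neg, strand_scalarBracket, strand_scalarBracket,
      bracket_of_not_admissible fun h => hcard h.2.2.1,
      bracket_of_not_admissible fun h => hcard h.2.2.1]
    simp

theorem strand_single_self (a : Fin d →₀ ℕ) (p : AdmissiblePair r k i) :
    strand K m k i (a + lcmExp m (p.1.1 ∪ p.1.2)) (Finsupp.single (p.1.1, p.1.2) 1) =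
      Finsupp.single p (MvPolynomial.monomial a (1 : K)) := by
  rw [strand_single, add_tsub_cancel_right, bracket_of_admissible p.2, Finsupp.smul_single,
    smul_eq_mul, mul_one]

/-- Every element of `F_i` is a sum of elements of strands. -/
theorem linearMap_ext_strand {M : Type*} [AddCommGroup M] [Module K M]
    {φ ψ : PairModule K d r k i →ₗ[K] M}
    (h : ∀ (b : Fin d →₀ ℕ) (σ τ : Finset (Fin r)), Admissible k i σ τ →
      (σ, τ) ∈ pairsIn k (verticesBelow m b) →
      φ (strand K m k i b (Finsupp.single (σ, τ) 1)) =
        ψ (strand K m k i b (Finsupp.single (σ, τ) 1))) : φ = ψ := by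
  refine Finsupp.lhom_ext' fun p => (MvPolynomial.basisMonomials (Fin d) K).ext fun a => ?_
  have := h (a + lcmExp m (p.1.1 ∪ p.1.2)) p.1.1 p.1.2 p.2
    ⟨p.2.1, p.2.2.1, p.2.2.2.2, lcmExp_le_iff.mp le_add_self⟩
  rw [strand_single_self] at this
  simpa using this

theorem lcmDifferential_comp_self (z : PairModule K d r k (i + 2)) :
    lcmDifferential K m k i (lcmDifferential K m k (i + 1) z) = 0 := by
  refine LinearMap.congr_fun (linearMap_ext_strand m (ψ := 0)
    (φ := (lcmDifferential K m k i).restrictScalars K ∘ₗ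
      (lcmDifferential K m k (i + 1)).restrictScalars K) fun b σ τ _ hp => ?_) z
  have hc := single_mem_scalarComplex hp (1 : K)
  simp only [LinearMap.comp_apply, LinearMap.restrictScalars_apply]
  rw [lcmDifferential_strand m b hc, lcmDifferential_strand m b (scalarDifferential_mem hc),
    scalarDifferential_comp_self hc, map_zero, LinearMap.zero_apply]

theorem lcmAugmentation_single {σ : Finset (Fin r)} (h : Admissible k 0 σ ∅) :
    (lcmAugmentation K m k (Finsupp.single ⟨(σ, ∅), h⟩ 1) : MvPolynomial (Fin d) K) =
      MvPolynomial.monomial (lcmExp m σ) 1 := by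
  rw [lcmAugmentation, Finsupp.linearCombination_single, one_smul]

theorem lcmAugmentation_strand (b : Fin d →₀ ℕ) {c : PairSpace K r}
    (hc : c ∈ scalarComplex K k (verticesBelow m b)) :
    (lcmAugmentation K m k (strand K m k 0 b c) : MvPolynomial (Fin d) K) =
      MvPolynomial.monomial b (scalarAugmentation K c) := by
  refine eq_of_eq_single (((lcmIdeal K m k).subtype ∘ₗ lcmAugmentation K m k).restrictScalars K ∘ₗ
    strand K m k 0 b) (MvPolynomial.monomial b ∘ₗ scalarAugmentation K) (fun σ τ hp => ?_) hc
  simp only [LinearMap.comp_apply, LinearMap.restrictScalars_apply]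
  rw [strand_single, scalarAugmentation_single, map_smul, map_smul]
  by_cases hτ : τ = ∅
  · subst hτ
    have hadm : Admissible k 0 σ ∅ := ⟨hp.1, hp.2.1, Finset.card_empty, hp.2.2.1⟩
    have hb := lcmExp_le_iff.mpr hp.2.2.2
    simp only [Finset.union_empty] at hb ⊢
    rw [if_pos trivial, bracket_of_admissible hadm, Submodule.subtype_apply,
      lcmAugmentation_single, smul_eq_mul, MvPolynomial.monomial_mul, one_mul,
      tsub_add_cancel_of_le hb]
  · rw [bracket_of_not_admissible fun h => hτ (Finset.card_eq_zero.mp h.2.2.1), if_neg hτ]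
    simp

theorem lcmAugmentation_lcmDifferential (z : PairModule K d r k 1) :
    lcmAugmentation K m k (lcmDifferential K m k 0 z) = 0 := by
  refine LinearMap.congr_fun (linearMap_ext_strand m (ψ := 0)
    (φ := (lcmAugmentation K m k).restrictScalars K ∘ₗ
      (lcmDifferential K m k 0).restrictScalars K) fun b σ τ _ hp => ?_) z
  have hc := single_mem_scalarComplex hp (1 : K)
  simp only [LinearMap.comp_apply, LinearMap.restrictScalars_apply]
  apply Subtype.ext
  rw [lcmDifferential_strand m b hc, lcmAugmentation_strand m b (scalarDifferential_mem hc),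
    scalarAugmentation_scalarDifferential hc]
  simp

theorem lcmAugmentation_surjective : Function.Surjective (lcmAugmentation K m k) := by
  have hle : lcmIdeal K m k ≤
      (LinearMap.range (lcmAugmentation K m k)).map (lcmIdeal K m k).subtype := by
    refine Ideal.span_le.mpr ?_
    rintro _ ⟨σ, hσ, rfl⟩
    have hadm : Admissible k 0 σ ∅ := ⟨Finset.disjoint_empty_right σ, hσ, Finset.card_empty,
      fun t ht => absurd ht (Finset.notMem_empty t)⟩
    refine ⟨_, ⟨Finsupp.single ⟨(σ, ∅), hadm⟩ 1, rfl⟩, lcmAugmentation_single m hadm⟩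
  rintro ⟨g, hg⟩
  obtain ⟨y, ⟨z, rfl⟩, hy⟩ := hle hg
  exact ⟨z, Subtype.ext hy⟩

/-! ### The contracting homotopy -/

variable (K k i)

/-- A contracting homotopy of the augmented scalar complex of `W`. It is chosen as a map on all of
`PairSpace K r` and is not required to be homogeneous. -/
noncomputable def scalarHomotopy (W : Finset (Fin r)) : PairSpace K r →ₗ[K] PairSpace K r :=
  (exists_scalarHomotopy (K := K) k W).choose

/-- The image of `1` under the contracting homotopy of the augmented scalar complex of `W`. -/
noncomputable def scalarUnit (W : Finset (Fin r)) : PairSpace K r :=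
  (exists_scalarHomotopy (K := K) k W).choose_spec.choose

/-- The `K`-linear homotopy of `𝐈_k` that acts on each strand as the scalar homotopy of its vertex
set. -/
noncomputable def strandHomotopy : PairModule K d r k i →ₗ[K] PairModule K d r k (i + 1) :=
  Finsupp.lsum K fun p => (MvPolynomial.basisMonomials (Fin d) K).constr K fun a =>
    strand K m k (i + 1) (a + lcmExp m (p.1.1 ∪ p.1.2))
      (scalarHomotopy K k (verticesBelow m (a + lcmExp m (p.1.1 ∪ p.1.2)))
        (Finsupp.single (p.1.1, p.1.2) 1))

/-- The `K`-linear map that sends `x^b` to the unit of the strand of multidegree `b`. -/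
noncomputable def strandUnit : MvPolynomial (Fin d) K →ₗ[K] PairModule K d r k 0 :=
  (MvPolynomial.basisMonomials (Fin d) K).constr K fun b =>
    strand K m k 0 b (scalarUnit K k (verticesBelow m b))

variable {K k i}

theorem scalarHomotopy_mem {W : Finset (Fin r)} {c : PairSpace K r}
    (hc : c ∈ scalarComplex K k W) : scalarHomotopy K k W c ∈ scalarComplex K k W :=
  (exists_scalarHomotopy (K := K) k W).choose_spec.choose_spec.1 c hc

theorem scalarHomotopy_spec {W : Finset (Fin r)} {c : PairSpace K r}
    (hc : c ∈ scalarComplex K k W) :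
    scalarDifferential K (scalarHomotopy K k W c) + scalarHomotopy K k W (scalarDifferential K c) =
      c - scalarAugmentation K c • scalarUnit K k W :=
  (exists_scalarHomotopy (K := K) k W).choose_spec.choose_spec.2 c hc

theorem strandUnit_monomial (b : Fin d →₀ ℕ) (a : K) :
    strandUnit K m k (MvPolynomial.monomial b a) =
      a • strand K m k 0 b (scalarUnit K k (verticesBelow m b)) := by
  have h : MvPolynomial.monomial b a =
      a • (MvPolynomial.basisMonomials (Fin d) K b) := by
    simp [MvPolynomial.smul_monomial]
  rw [strandUnit, h, map_smul, Module.Basis.constr_basis]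

theorem strandHomotopy_strand_single {b : Fin d →₀ ℕ} {σ τ : Finset (Fin r)}
    (h : Admissible k i σ τ) (hp : (σ, τ) ∈ pairsIn k (verticesBelow m b)) :
    strandHomotopy K m k i (strand K m k i b (Finsupp.single (σ, τ) 1)) =
      strand K m k (i + 1) b
        (scalarHomotopy K k (verticesBelow m b) (Finsupp.single (σ, τ) 1)) := by
  have hb : lcmExp m (σ ∪ τ) ≤ b := lcmExp_le_iff.mpr hp.2.2.2
  rw [strand_single, bracket_of_admissible h, Finsupp.smul_single, smul_eq_mul, mul_one,
    strandHomotopy, Finsupp.lsum_single]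
  have := (MvPolynomial.basisMonomials (Fin d) K).constr_basis K (fun a =>
    strand K m k (i + 1) (a + lcmExp m (σ ∪ τ))
      (scalarHomotopy K k (verticesBelow m (a + lcmExp m (σ ∪ τ)))
        (Finsupp.single (σ, τ) 1))) (b - lcmExp m (σ ∪ τ))
  rw [MvPolynomial.coe_basisMonomials, tsub_add_cancel_of_le hb] at this
  exact this

/-- Only homogeneous `c` are allowed: the scalar homotopy of an arbitrary `c` may have components in
several homological degrees. -/
theorem strandHomotopy_strand {b : Fin d →₀ ℕ} {c : PairSpace K r}
    (hc : c ∈ scalarComplex K k (verticesBelow m b))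
    (hi : c ∈ Finsupp.supported K K {p : Finset (Fin r) × Finset (Fin r) | p.2.card = i}) :
    strandHomotopy K m k i (strand K m k i b c) =
      strand K m k (i + 1) b (scalarHomotopy K k (verticesBelow m b) c) := by
  have hmem : c ∈ Finsupp.supported K K (pairsIn k (verticesBelow m b) ∩
      {p : Finset (Fin r) × Finset (Fin r) | p.2.card = i}) := by
    rw [Finsupp.supported_inter]
    exact ⟨hc, hi⟩
  exact eq_of_eq_single (strandHomotopy K m k i ∘ₗ strand K m k i b)
    (strand K m k (i + 1) b ∘ₗ scalarHomotopy K k (verticesBelow m b))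
    (fun σ τ hp => strandHomotopy_strand_single m ⟨hp.1.1, hp.1.2.1, hp.2, hp.1.2.2.1⟩ hp.1) hmem

theorem scalarBracket_mem_supported_card (σ : Finset (Fin r)) {τ : Finset (Fin r)}
    (h : τ.card = i) : scalarBracket K σ τ ∈
      Finsupp.supported K K {p : Finset (Fin r) × Finset (Fin r) | p.2.card = i} := by
  by_cases hdom : Dominates σ τ
  · rw [scalarBracket_of_dominates hdom]
    exact Finsupp.single_mem_supported K 1 h
  · rw [scalarBracket_of_not_dominates hdom]
    exact zero_mem _

theorem scalarDifferential_single_mem_supported_card (σ : Finset (Fin r)) {τ : Finset (Fin r)}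
    (h : τ.card = i + 1) : scalarDifferential K (Finsupp.single (σ, τ) 1) ∈
      Finsupp.supported K K {p : Finset (Fin r) × Finset (Fin r) | p.2.card = i} := by
  rw [scalarDifferential_single]
  refine Submodule.sum_mem _ fun j hj => Submodule.smul_mem _ _ ?_
  have hcard : (τ.erase j).card = i := by rw [Finset.card_erase_of_mem hj, h, Nat.add_sub_cancel]
  exact add_mem (neg_mem (scalarBracket_mem_supported_card σ hcard))
    (scalarBracket_mem_supported_card _ hcard)

theorem strandHomotopy_succ (z : PairModule K d r k (i + 1)) :
    lcmDifferential K m k (i + 1) (strandHomotopy K m k (i + 1) z) +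
      strandHomotopy K m k i (lcmDifferential K m k i z) = z := by
  refine LinearMap.congr_fun (linearMap_ext_strand m (ψ := LinearMap.id)
    (φ := (lcmDifferential K m k (i + 1)).restrictScalars K ∘ₗ strandHomotopy K m k (i + 1) +
      strandHomotopy K m k i ∘ₗ (lcmDifferential K m k i).restrictScalars K)
      fun b σ τ h hp => ?_) z
  have hc := single_mem_scalarComplex hp (1 : K)
  have hτ : τ ≠ ∅ := by
    rintro rfl
    exact absurd h.2.2.1 (by simp)
  simp only [LinearMap.add_apply, LinearMap.comp_apply, LinearMap.restrictScalars_apply,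
    LinearMap.id_apply]
  rw [strandHomotopy_strand_single m h hp, lcmDifferential_strand m b hc,
    lcmDifferential_strand m b (scalarHomotopy_mem hc),
    strandHomotopy_strand m (scalarDifferential_mem hc)
      (scalarDifferential_single_mem_supported_card σ h.2.2.1),
    ← map_add, scalarHomotopy_spec hc, scalarAugmentation_single, if_neg hτ, zero_smul, sub_zero]

theorem strandHomotopy_zero (z : PairModule K d r k 0) :
    lcmDifferential K m k 0 (strandHomotopy K m k 0 z) =
      z - strandUnit K m k (lcmAugmentation K m k z) := by
  refine LinearMap.congr_fun (linearMap_ext_strand m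
    (φ := (lcmDifferential K m k 0).restrictScalars K ∘ₗ strandHomotopy K m k 0)
    (ψ := LinearMap.id - strandUnit K m k ∘ₗ
      ((lcmIdeal K m k).subtype ∘ₗ lcmAugmentation K m k).restrictScalars K)
      fun b σ τ h hp => ?_) z
  have hc := single_mem_scalarComplex hp (1 : K)
  have hτ : τ = ∅ := Finset.card_eq_zero.mp h.2.2.1
  have hD : scalarDifferential K (Finsupp.single (σ, τ) 1) = 0 := by
    rw [scalarDifferential_single, hτ, Finset.sum_empty]
  simp only [LinearMap.sub_apply, LinearMap.comp_apply, LinearMap.restrictScalars_apply,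
    LinearMap.id_apply, Submodule.subtype_apply]
  have hspec := scalarHomotopy_spec hc
  rw [hD, map_zero, add_zero] at hspec
  rw [strandHomotopy_strand_single m h hp, lcmDifferential_strand m b (scalarHomotopy_mem hc),
    hspec, lcmAugmentation_strand m b hc, strandUnit_monomial, map_sub, map_smul]

variable (K k)

theorem isFreeResolution_lcm : IsFreeResolution (MvPolynomial (Fin d) K)
    (PairModule K d r k) (lcmIdeal K m k) (lcmDifferential K m k) (lcmAugmentation K m k) where
  free _ := inferInstance
  exact_succ i z := by
    constructor
    · intro hz
      refine ⟨strandHomotopy K m k (i + 1) z, ?_⟩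
      have := strandHomotopy_succ m z
      rwa [hz, map_zero, add_zero] at this
    · rintro ⟨y, rfl⟩
      exact lcmDifferential_comp_self m y
  exact_zero z := by
    constructor
    · intro hz
      refine ⟨strandHomotopy K m k 0 z, ?_⟩
      rw [strandHomotopy_zero, hz, ZeroMemClass.coe_zero, map_zero, sub_zero]
    · rintro ⟨y, rfl⟩
      exact lcmAugmentation_lcmDifferential m y
  surjective := lcmAugmentation_surjective m

end Strands

/-! ### Free resolutions as projective resolutions -/

section Resolution

variable {S : Type u} [CommRing S] {F : ℕ → Type u} [∀ i, AddCommGroup (F i)]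
  [∀ i, Module S (F i)] {M : Type u} [AddCommGroup M] [Module S M]
  {δ : ∀ i, F (i + 1) →ₗ[S] F i} {ε : F 0 →ₗ[S] M}

/-- The chain complex underlying a free resolution. -/
noncomputable def IsFreeResolution.chainComplex (h : IsFreeResolution S F M δ ε) :
    ChainComplex (ModuleCat.{u} S) ℕ :=
  ChainComplex.of (fun i => ModuleCat.of S (F i)) (fun i => ModuleCat.ofHom (δ i)) fun i => by
    rw [← ModuleCat.ofHom_comp, (h.exact_succ i).linearMap_comp_eq_zero]
    rfl

theorem IsFreeResolution.chainComplex_d (h : IsFreeResolution S F M δ ε) (i : ℕ) :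
    h.chainComplex.d (i + 1) i = ModuleCat.ofHom (δ i) := by
  simp [chainComplex, ChainComplex.of]

/-- A free resolution, as a projective resolution in the category of modules. -/
noncomputable def IsFreeResolution.projectiveResolution (h : IsFreeResolution S F M δ ε) :
    ProjectiveResolution (ModuleCat.of S M) where
  complex := h.chainComplex
  projective i := by
    have := h.free i
    exact ModuleCat.projective_of_free (Module.Free.chooseBasis S (F i))
  π := (ChainComplex.toSingle₀Equiv h.chainComplex (ModuleCat.of S M)).symm
    ⟨ModuleCat.ofHom ε, by
      rw [h.chainComplex_d 0]
      exact ModuleCat.hom_ext h.exact_zero.linearMap_comp_eq_zero⟩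
  quasiIso := ⟨fun i => by
    cases i with
    | zero =>
      rw [ChainComplex.quasiIsoAt₀_iff, ShortComplex.quasiIso_iff_of_zeros' _ rfl rfl rfl]
      constructor
      · rw [ShortComplex.moduleCat_exact_iff]
        intro x hx
        obtain ⟨y, hy⟩ := (h.exact_zero x).mp (by simpa [ChainComplex.toSingle₀Equiv] using! hx)
        refine ⟨y, ?_⟩
        refine Eq.trans ?_ hy
        exact congrArg (fun f => f.hom y) (h.chainComplex_d 0)
      · rw [ModuleCat.epi_iff_surjective]
        intro x
        obtain ⟨y, hy⟩ := h.surjective x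
        exact ⟨y, by simpa [ChainComplex.toSingle₀Equiv] using! hy⟩
    | succ i =>
      rw [quasiIsoAt_iff_exactAt' (hL := ChainComplex.exactAt_succ_single_obj ..),
        HomologicalComplex.exactAt_iff' _ (i + 2) (i + 1) i (by simp) (by simp),
        ShortComplex.moduleCat_exact_iff]
      intro x hx
      obtain ⟨y, hy⟩ := (h.exact_succ i x).mp
        ((congrArg (fun f => f.hom x) (h.chainComplex_d i)).symm.trans hx)
      exact ⟨y, (congrArg (fun f => f.hom y) (h.chainComplex_d (i + 1))).trans hy⟩⟩

end Resolution

/-! ### Dimension of homology -/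

section Rank

variable {K : Type u} [Field K] {S : Type u} [CommRing S] [Algebra K S]

/-- The dimension over `K` of a module over a `K`-algebra `S`. -/
noncomputable def rankOver (K : Type u) [Field K] {S : Type u} [CommRing S] [Algebra K S]
    (M : ModuleCat.{u} S) : Cardinal.{u} :=
  Module.rank K ((ModuleCat.restrictScalars (algebraMap K S)).obj M)

theorem rankOver_le_of_mono {M N : ModuleCat.{u} S} (f : M ⟶ N) [Mono f] :
    rankOver K M ≤ rankOver K N :=
  LinearMap.rank_le_of_injective ((ModuleCat.restrictScalars (algebraMap K S)).map f).hom
    ((ModuleCat.mono_iff_injective f).mp inferInstance)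

theorem rankOver_le_of_epi {M N : ModuleCat.{u} S} (f : M ⟶ N) [Epi f] :
    rankOver K N ≤ rankOver K M :=
  LinearMap.rank_le_of_surjective ((ModuleCat.restrictScalars (algebraMap K S)).map f).hom
    ((ModuleCat.epi_iff_surjective f).mp inferInstance)

theorem rankOver_eq_of_iso {M N : ModuleCat.{u} S} (e : M ≅ N) :
    rankOver K M = rankOver K N :=
  le_antisymm (rankOver_le_of_mono e.hom) (rankOver_le_of_mono e.inv)

theorem rankOver_of (M : Type u) [AddCommGroup M] [Module S M] [Module K M]
    [IsScalarTower K S M] : rankOver K (ModuleCat.of S M) = Module.rank K M := by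
  let e : (ModuleCat.restrictScalars (algebraMap K S)).obj (ModuleCat.of S M) ≃ₗ[K] M :=
    { AddEquiv.refl M with
      map_smul' := fun c x => algebraMap_smul (M := M) S c x }
  exact e.rank_eq

theorem rankOver_homology_le (C : ChainComplex (ModuleCat.{u} S) ℕ) (i : ℕ) :
    rankOver K (C.homology i) ≤ rankOver K (C.X i) :=
  (rankOver_le_of_epi (C.homologyπ i)).trans (rankOver_le_of_mono (C.iCycles i))

theorem rankOver_homology_eq (C : ChainComplex (ModuleCat.{u} S) ℕ)
    (hC : ∀ i, C.d (i + 1) i = 0) (i : ℕ) :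
    rankOver K (C.homology i) = rankOver K (C.X i) := by
  have hd : ∀ a b, C.d a b = 0 := fun a b => by
    by_cases h : b + 1 = a
    · subst h
      exact hC b
    · exact C.shape a b h
  have h1 := C.isIso_iCycles i _ rfl (hd _ _)
  have h2 := C.isIso_homologyπ _ i rfl (hd _ _)
  exact rankOver_eq_of_iso ((asIso (C.homologyπ i)).symm ≪≫ asIso (C.iCycles i))

end Rank

/-! ### Tor from a free resolution -/

section Tor

variable {S : Type u} [CommRing S] {F : ℕ → Type u} [∀ i, AddCommGroup (F i)]
  [∀ i, Module S (F i)] {M : Type u} [AddCommGroup M] [Module S M]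
  {δ : ∀ i, F (i + 1) →ₗ[S] F i} {ε : F 0 →ₗ[S] M}

/-- The complex `Q ⊗ F`, for a free resolution `F`. -/
noncomputable def IsFreeResolution.tensorComplex (h : IsFreeResolution S F M δ ε)
    (Q : ModuleCat.{u} S) : ChainComplex (ModuleCat.{u} S) ℕ :=
  (((MonoidalCategory.tensoringLeft (ModuleCat.{u} S)).obj Q).mapHomologicalComplex _).obj
    h.chainComplex

/-- `Tor_i (Q, M)` as the homology of `Q ⊗ F`, for a free resolution `F` of `M`. -/
noncomputable def IsFreeResolution.torIso (h : IsFreeResolution S F M δ ε)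
    (Q : ModuleCat.{u} S) (i : ℕ) :
    ((Tor (ModuleCat.{u} S) i).obj Q).obj (ModuleCat.of S M) ≅ (h.tensorComplex Q).homology i :=
  h.projectiveResolution.isoLeftDerivedObj
    ((MonoidalCategory.tensoringLeft (ModuleCat.{u} S)).obj Q) i

/-- If the differential of the resolution is zero modulo an ideal `I` that annihilates `Q`, then
the differential of `Q ⊗ F` is zero. -/
theorem IsFreeResolution.tensorComplex_d_eq_zero (h : IsFreeResolution S F M δ ε)
    (Q : Type u) [AddCommGroup Q] [Module S Q] (I : Ideal S) (hQ : ∀ a ∈ I, ∀ q : Q, a • q = 0)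
    (hδ : ∀ i z, δ i z ∈ I • (⊤ : Submodule S (F i))) (i : ℕ) :
    (h.tensorComplex (ModuleCat.of S Q)).d (i + 1) i = 0 := by
  have hd : (h.tensorComplex (ModuleCat.of S Q)).d (i + 1) i =
      ModuleCat.ofHom (LinearMap.lTensor Q (δ i)) := by
    change MonoidalCategory.whiskerLeft (ModuleCat.of S Q) (h.chainComplex.d (i + 1) i) = _
    rw [h.chainComplex_d]
    rfl
  rw [hd]
  refine ModuleCat.hom_ext (TensorProduct.ext' fun q z => ?_)
  change q ⊗ₜ[S] δ i z = 0
  refine Submodule.smul_induction_on (p := fun y => q ⊗ₜ[S] y = 0) (hδ i z) (fun a ha y _ => ?_)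
    fun x y hx hy => ?_
  · rw [← TensorProduct.smul_tmul, hQ a ha, TensorProduct.zero_tmul]
  · rw [TensorProduct.tmul_add, hx, hy, add_zero]

end Tor

/-! ### Betti numbers -/

section Betti

variable {K : Type u} [Field K] {d r : ℕ}

/-- The residue field of `K[x_1, …, x_d]` at the ideal generated by the variables. -/
abbrev ResidueField (K : Type u) [Field K] (d : ℕ) : Type u :=
  MvPolynomial (Fin d) K ⧸ MvPolynomial.idealOfVars (Fin d) K

theorem mem_idealOfVars_iff {p : MvPolynomial (Fin d) K} :
    p ∈ MvPolynomial.idealOfVars (Fin d) K ↔ p.coeff 0 = 0 := by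
  have h := MvPolynomial.mem_pow_idealOfVars_iff' 1 p
  rw [pow_one] at h
  simp [h, Finsupp.degree_eq_zero_iff]

theorem rank_residueField : Module.rank K (ResidueField K d) = 1 := by
  have hker : RingHom.ker (MvPolynomial.aeval (fun _ : Fin d => (0 : K))) =
      MvPolynomial.idealOfVars (Fin d) K := by
    ext p
    rw [mem_idealOfVars_iff, RingHom.mem_ker, MvPolynomial.aeval_zero']
    simp [MvPolynomial.constantCoeff_eq]
  have hsurj : Function.Surjective (MvPolynomial.aeval (fun _ : Fin d => (0 : K))) :=
    fun a => ⟨MvPolynomial.C a, by simp⟩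
  have e := (Ideal.quotientEquivAlgOfEq K hker.symm).trans
    (Ideal.quotientKerAlgEquivOfSurjective hsurj)
  rw [e.toLinearEquiv.rank_eq, Module.rank_self]

theorem rankOver_tensor_finsupp (ι : Type) [Finite ι] :
    rankOver K (ModuleCat.of (MvPolynomial (Fin d) K)
      (TensorProduct (MvPolynomial (Fin d) K) (ResidueField K d) (ι →₀ MvPolynomial (Fin d) K))) =
      Nat.card ι := by
  classical
  rw [rankOver_eq_of_iso (TensorProduct.finsuppScalarRight (MvPolynomial (Fin d) K)
    (MvPolynomial (Fin d) K) (ResidueField K d) ι).toModuleIso, rankOver_of]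
  have := Fintype.ofFinite ι
  simp [rank_finsupp, rank_residueField]

theorem lcmExp_single_apply (A : Finset (Fin r)) (x : Fin r) :
    lcmExp (fun i => Finsupp.single i 1) A x = if x ∈ A then 1 else 0 := by
  classical
  induction A using Finset.induction_on with
  | empty => rfl
  | insert a A _ ih =>
    rw [lcmExp, Finset.sup_insert, Finsupp.sup_apply, ← lcmExp, ih, Finsupp.single_apply]
    by_cases hx : x = a
    · subst hx
      by_cases hA : x ∈ A <;> simp [hA]
    · by_cases hA : x ∈ A <;> simp [hx, hA, Ne.symm hx]

/-- The `k`-out-of-`r` ideal is the `k`-fold lcm-ideal of the variables. -/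
theorem kOutOfIdeal_eq_lcmIdeal (k r : ℕ) :
    kOutOfIdeal K k r = lcmIdeal K (fun i : Fin r => Finsupp.single i 1) k := by
  have h : ∀ σ : Finset (Fin r), ∏ i ∈ σ, (MvPolynomial.X i : MvPolynomial (Fin r) K) =
      MvPolynomial.monomial (lcmExp (fun i : Fin r => Finsupp.single i 1) σ) 1 := fun σ => by
    have hexp : lcmExp (fun i : Fin r => Finsupp.single i 1) σ =
        ∑ i ∈ σ, Finsupp.single i 1 := by
      ext x
      rw [lcmExp_single_apply, Finsupp.finsetSum_apply]
      simp [Finsupp.single_apply]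
    rw [hexp, MvPolynomial.monomial_sum_one]
    rfl
  simp only [kOutOfIdeal, lcmIdeal, h]

theorem monomial_sub_erase_mem {A : Finset (Fin r)} {a : Fin r} (ha : a ∈ A) :
    MvPolynomial.monomial (lcmExp (fun i : Fin r => Finsupp.single i 1) A -
      lcmExp (fun i : Fin r => Finsupp.single i 1) (A.erase a)) (1 : K) ∈
      MvPolynomial.idealOfVars (Fin r) K := by
  rw [mem_idealOfVars_iff, MvPolynomial.coeff_monomial, if_neg]
  intro h
  have := DFunLike.congr_fun h a
  simp [lcmExp_single_apply, ha] at this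

/-- The resolution of the `k`-out-of-`r` ideal is minimal: its differential is zero modulo the
variables. -/
theorem lcmDifferential_single_mem (k i : ℕ) (z : PairModule K r r k (i + 1)) :
    lcmDifferential K (fun i : Fin r => Finsupp.single i 1) k i z ∈
      MvPolynomial.idealOfVars (Fin r) K • (⊤ : Submodule (MvPolynomial (Fin r) K)
        (PairModule K r r k i)) := by
  induction z using Finsupp.induction_linear with
  | zero => rw [map_zero]; exact zero_mem _
  | add x y hx hy => rw [map_add]; exact add_mem hx hy
  | single p a =>
    obtain ⟨⟨σ, τ⟩, h⟩ := p
    have hσ : σ.Nonempty := AdmissiblePair.nonempty ⟨(σ, τ), h⟩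
    rw [← mul_one a, ← smul_eq_mul, ← Finsupp.smul_single, map_smul, lcmDifferential_single _ h hσ]
    refine Submodule.smul_mem _ _ (Submodule.sum_mem _ fun j hj => Submodule.smul_mem _ _
      (add_mem (neg_mem ?_) ?_))
    · exact Submodule.smul_mem_smul
        (monomial_sub_erase_mem (Finset.mem_union_right _ hj)) Submodule.mem_top
    · exact Submodule.smul_mem_smul
        (monomial_sub_erase_mem (Finset.mem_union_left _ (σ.max'_mem hσ))) Submodule.mem_top

theorem bettiNumber_lcmIdeal_le (m : Fin r → (Fin d →₀ ℕ)) (k i : ℕ) :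
    bettiNumber i (lcmIdeal K m k) ≤ Nat.card (AdmissiblePair r k i) := by
  have h := isFreeResolution_lcm K m k
  let Q := ModuleCat.of (MvPolynomial (Fin d) K) (ResidueField K d)
  calc bettiNumber i (lcmIdeal K m k) = rankOver K ((h.tensorComplex Q).homology i) :=
        rankOver_eq_of_iso (h.torIso Q i)
    _ ≤ rankOver K ((h.tensorComplex Q).X i) := rankOver_homology_le _ i
    _ = Nat.card (AdmissiblePair r k i) := rankOver_tensor_finsupp (AdmissiblePair r k i)

theorem bettiNumber_kOutOfIdeal (k r i : ℕ) :
    bettiNumber i (kOutOfIdeal K k r) = Nat.card (AdmissiblePair r k i) := by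
  rw [kOutOfIdeal_eq_lcmIdeal]
  have h := isFreeResolution_lcm K (fun i : Fin r => Finsupp.single i 1) k
  let Q := ModuleCat.of (MvPolynomial (Fin r) K) (ResidueField K r)
  have hd := h.tensorComplex_d_eq_zero (ResidueField K r) (MvPolynomial.idealOfVars (Fin r) K)
    (fun a ha q => by
      obtain ⟨q, rfl⟩ := Ideal.Quotient.mk_surjective q
      rw [← Ideal.Quotient.mk_eq_mk, ← Submodule.Quotient.mk_smul]
      exact (Submodule.Quotient.mk_eq_zero _).mpr (Ideal.mul_mem_right q _ ha))
    (lcmDifferential_single_mem k)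
  calc bettiNumber i (lcmIdeal K (fun i : Fin r => Finsupp.single i 1) k) =
        rankOver K ((h.tensorComplex Q).homology i) := rankOver_eq_of_iso (h.torIso Q i)
    _ = rankOver K ((h.tensorComplex Q).X i) := rankOver_homology_eq _ hd i
    _ = Nat.card (AdmissiblePair r k i) := rankOver_tensor_finsupp (AdmissiblePair r k i)

end Betti

end LcmFiltration

theorem mainTheorem1 {K : Type u} [Field K] {d r : ℕ} (m : Fin r → (Fin d →₀ ℕ)) (k : ℕ) :
    LcmFiltration.IsFreeResolution (MvPolynomial (Fin d) K)
      (LcmFiltration.PairModule K d r k) (LcmFiltration.lcmIdeal K m k)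
      (LcmFiltration.lcmDifferential K m k) (LcmFiltration.lcmAugmentation K m k) ∧
    ∀ i : ℕ, LcmFiltration.bettiNumber i (LcmFiltration.lcmIdeal K m k) ≤
      LcmFiltration.bettiNumber i (LcmFiltration.kOutOfIdeal K k r) := by
  refine ⟨LcmFiltration.isFreeResolution_lcm K m k, fun i => ?_⟩
  rw [LcmFiltration.bettiNumber_kOutOfIdeal]
  exact LcmFiltration.bettiNumber_lcmIdeal_le m k i
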